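/- Let $d,c,c_{\mathcal F},c_{\mathcal B}\in\mathbb N$ with $d,c\ge 1$, let $\Omega\subset\mathbb R^d$ be open (in particular, $\Omega$ may be any bounded Lipschitz domain), let $\Gamma\subseteq\partial\Omega$, and let $r_{\mathcal F},r_{\mathcal B}\in\mathbb N_0$. Let $U\subseteq C^{r_{\mathcal F}}(\Omega,\mathbb R^c)\cap C^{r_{\mathcal B}}(\overline\Omega,\mathbb R^c)$ be a set (for example a Banach space) of functions $u:\overline\Omega\to\mathbb R^c$, where $u\in C^{r}(\overline\Omega,\mathbb R^c)$ means that $u$ is continuous on $\overline\Omega$, is $C^{r}$ in $\Omega$, and every $D^\beta u$ with $|\beta|\le r$ extends continuously from $\Omega$ to $\overline\Omega$. For $z\in\partial\Omega$, $D^\beta u(z)$ denotes the trace $\lim_{x\to z,\,x\in\Omega}D^\beta u(x)$. Let $\mathcal F$ and $\mathcal B$ be (possibly nonlinear) operators assigning to $u\in U$ functions $\mathcal F(u):\Omega\to\mathbb R^{c_{\mathcal F}}$ and $\mathcal B(u):\Gamma\to\mathbb R^{c_{\mathcal B}}$ of the local form $$\mathcal F(u)(z)=F\bigl(z,\{D^\beta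 u(z):|\beta|\le r_{\mathcal F}\}\bigr)\ (z\in\Omega),\qquad \mathcal B(u)(z)=B\bigl(z,\{D^\beta u(z):|\beta|\le r_{\mathcal B}\}\bigr)\ (z\in\Gamma)$$ for some functions $F,B$. Write $\widehat{\mathcal F}(u)(z)$ and $\widehat{\mathcal B}(u)(z)$ for the same expressions evaluated at any $u:\overline\Omega\to\mathbb R^c$ that has the required derivatives at $z$. Let $\Omega^h\subset\Omega$ and $\Gamma^h\subset\Gamma$ be finite nonempty sets with $N_{\mathcal F}$ and $N_{\mathcal B}$ elements, let $\mathcal D^h\subseteq\Omega^h\cup\Gamma^h$, let $u^*$ be $\mathbb R^c$-valued data on $\mathcal D^h$, let $\alpha_{\mathcal F},\alpha_{\mathcal B}\ge 0$, $\nu\in[1,\infty)$, let the quadrature weights $\omega^z_{\mathcal F}$ ($z\in\Omega^h$) and $\omega^z_{\mathcal B}$ ($z\in\Gamma^h$) be nonnegative, and let $\omega^z_{\mathcal D}\in\mathbb R$. With $|y|_\nu^\nu=\sum_i|y_i|^\nu$, the AD-PINN loss is $$\mathcal J^h(u)=\alpha_{\mathcal F}\sum_{z\in\Omega^h}\omega_{\mathcal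 F}^z\,|\widehat{\mathcal F}(u)(z)|_\nu^\nu+\alpha_{\mathcal B}\sum_{z\in\Gamma^h}\omega_{\mathcal B}^z\,|\widehat{\mathcal B}(u)(z)|_\nu^\nu+\alpha_{\mathcal D}\sum_{z\in\mathcal D^h}\omega_{\mathcal D}^z\,|u(z)-u^*(z)|_\nu^\nu .$$ Set $\ell=N_{\mathcal F}(d+r_{\mathcal F})+N_{\mathcal B}(d+r_{\mathcal B})$ and let $\sigma\in C^{\ell-d}(\mathbb R,\mathbb R)$ satisfy $\sigma^{(k)}(a)\ne 0$ for some $a\in\mathbb R$ and all $0\le k\le\ell-d$. Let $\mathcal H$ be the set of restrictions to $\overline\Omega$ of all one-hidden-layer (depth-$2$) fully connected networks $x\mapsto W_2\,\sigma(W_1x+b_1)+b_2$ from $\mathbb R^d$ to $\mathbb R^c$, with $\sigma$ acting componentwise and arbitrary finite positive hidden width, and let $\mathcal H^M\subset\mathcal H$ be the set of those functions realized by such networks with exactly $M=c\binom{\ell}{d}(d+1)+c\bigl(c\binom{\ell}{d}+1\bigr)$ parameters, that is, with $c\binom{\ell}{d}$ hidden units. Assume that $\alpha_{\mathcal D}=0$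 and that there is $\hat u\in U$ with $\mathcal F(\hat u)(z)=0$ for all $z\in\Omega$ and $\mathcal B(\hat u)(z)=0$ for all $z\in\Gamma$. Then there exists $u_\theta\in\mathcal H^M$ which minimizes $\mathcal J^h$ over $\mathcal H$, and $\mathcal J^h(u_\theta)=0$. -/

import Mathlib

open Topology

noncomputable section

namespace ADPINN

/-- The Euclidean space `ℝ^d`. -/
abbrev E (d : ℕ) : Type := EuclideanSpace ℝ (Fin d)

/-! ### Multi-indices, classical partial derivatives, function spaces -/

/-- Multi-indices `β ∈ ℕ₀^d` with `|β| ≤ r`. -/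
abbrev MultiIndex (d r : ℕ) : Type := {β : Fin d → ℕ // ∑ i, β i ≤ r}

/-- The partial derivative `∂_i f`. -/
def partialDeriv {d c : ℕ} (i : Fin d) (f : E d → Fin c → ℝ) : E d → Fin c → ℝ :=
  fun x => lineDeriv ℝ f x (EuclideanSpace.single i 1)

/-- The iterated derivative `D^β f = ∂_1^{β_1} ⋯ ∂_d^{β_d} f`. -/
def multiDeriv {d c : ℕ} (β : Fin d → ℕ) (f : E d → Fin c → ℝ) : E d → Fin c → ℝ :=
  (List.finRange d).foldr (fun i g => (partialDeriv i)^[β i] g) f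

/-- A function on `closure Ω`, extended by zero to `ℝ^d`. Derivatives of the extension are only
taken at points of the open set `Ω`, where they do not depend on the extension. -/
def zeroExt {d c : ℕ} {Ω : Set (E d)} (u : closure Ω → Fin c → ℝ) : E d → Fin c → ℝ :=
  Function.extend Subtype.val u (fun _ => 0)

/-- Functions on `closure Ω` that are of class `C^r` in the open set `Ω`. -/
def ContDiffInterior {d : ℕ} (Ω : Set (E d)) (c r : ℕ) : Set (closure Ω → Fin c → ℝ) :=
  {u | ContDiffOn ℝ r (zeroExt u) Ω}

/-- The space `C^r(closure Ω, ℝ^c)`: continuous on `closure Ω`, of class `C^r` in `Ω`, and every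
`D^β u` with `|β| ≤ r` extends continuously from `Ω` to `closure Ω`. -/
def ContDiffClosure {d : ℕ} (Ω : Set (E d)) (c r : ℕ) : Set (closure Ω → Fin c → ℝ) :=
  {u | Continuous u ∧ ContDiffOn ℝ r (zeroExt u) Ω ∧
    ∀ β : MultiIndex d r, ∃ g : closure Ω → Fin c → ℝ, Continuous g ∧
      ∀ x : closure Ω, (x : E d) ∈ Ω → g x = multiDeriv β.1 (zeroExt u) x}

/-- The family `{D^β u(z) : |β| ≤ r}` at an interior point `z ∈ Ω`. -/
def interiorJet {d c : ℕ} {Ω : Set (E d)} (r : ℕ) (u : closure Ω → Fin c → ℝ) (z : E d) :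
    MultiIndex d r → Fin c → ℝ :=
  fun β => multiDeriv β.1 (zeroExt u) z

/-- The family `{D^β u(z) : |β| ≤ r}` at a boundary point `z ∈ ∂Ω`, where `D^β u(z)` is the trace
of `D^β u`, that is, the limit of `D^β u(x)` as `x → z` within `Ω`. -/
def boundaryJet {d c : ℕ} {Ω : Set (E d)} (r : ℕ) (u : closure Ω → Fin c → ℝ) (z : E d) :
    MultiIndex d r → Fin c → ℝ :=
  fun β => extendFrom Ω (multiDeriv β.1 (zeroExt u)) z

/-! ### Fully connected feedforward neural networks -/

/-- Parameters (weights and biases) of a neural network of depth `L` with input dimension `n` and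
output dimension `c`; all hidden layers have positive width. -/
inductive Net (c : ℕ) : ℕ → ℕ → Type
  /-- The linear output layer `x ↦ W x + b`. -/
  | output {n : ℕ} (W : Matrix (Fin c) (Fin n) ℝ) (b : Fin c → ℝ) : Net c 1 n
  /-- A hidden layer `x ↦ σ(W x + b)`, followed by the remaining layers. -/
  | hidden {L n m : ℕ} (hm : 0 < m) (W : Matrix (Fin m) (Fin n) ℝ) (b : Fin m → ℝ)
      (rest : Net c L m) : Net c (L + 1) n

/-- The function realized by a network with activation `σ` acting componentwise. -/
def Net.eval {c : ℕ} (σ : ℝ → ℝ) : {L n : ℕ} → Net c L n → (Fin n → ℝ) → (Fin c → ℝ)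
  | _, _, .output W b, x => W.mulVec x + b
  | _, _, .hidden _ W b rest, x => rest.eval σ (fun j => σ ((W.mulVec x + b) j))

/-- The total number of weights and biases of a network. -/
def Net.numParams {c : ℕ} : {L n : ℕ} → Net c L n → ℕ
  | _, n, .output _ _ => c * (n + 1)
  | _, n, .hidden (m := m) _ _ _ rest => m * (n + 1) + rest.numParams

/-- The class `𝓗` of depth-`L` networks `ℝ^d → ℝ^c` of arbitrary widths, restricted to
`closure Ω`. -/
def netClass {d : ℕ} (Ω : Set (E d)) (c : ℕ) (σ : ℝ → ℝ) (L : ℕ) :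
    Set (closure Ω → Fin c → ℝ) :=
  {u | ∃ N : Net c L d, ∀ x : closure Ω, u x = N.eval σ (x : E d)}

/-- The class `𝓗^M` of depth-`L` networks with exactly `M` parameters, restricted to
`closure Ω`. -/
def netClassParams {d : ℕ} (Ω : Set (E d)) (c : ℕ) (σ : ℝ → ℝ) (L M : ℕ) :
    Set (closure Ω → Fin c → ℝ) :=
  {u | ∃ N : Net c L d, N.numParams = M ∧ ∀ x : closure Ω, u x = N.eval σ (x : E d)}

/-! ### The AD-PINN loss -/

/-- `|y|_ν^ν = ∑ |y_i|^ν`. -/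
def powNorm {n : ℕ} (ν : ℝ) (y : Fin n → ℝ) : ℝ := ∑ i, |y i| ^ ν

/-- The AD-PINN functional with interior symbol `F` of order `rF` and boundary symbol `B` of order
`rB`, collocation sets `Ωh`, `Γh`, data locations `Dh` with data `ustar`, quadrature weights `ω`
and loss weights `α`. -/
def loss {d c cF cB : ℕ} {Ω : Set (E d)} {rF rB : ℕ}
    (F : E d → (MultiIndex d rF → Fin c → ℝ) → Fin cF → ℝ)
    (B : E d → (MultiIndex d rB → Fin c → ℝ) → Fin cB → ℝ)
    (Ωh Γh Dh : Finset (E d)) (ustar : E d → Fin c → ℝ)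
    (ωF ωB ωD : E d → ℝ) (αF αB αD ν : ℝ) (u : closure Ω → Fin c → ℝ) : ℝ :=
  αF * ∑ z ∈ Ωh, ωF z * powNorm ν (F z (interiorJet rF u z)) +
  αB * ∑ z ∈ Γh, ωB z * powNorm ν (B z (boundaryJet rB u z)) +
  αD * ∑ z ∈ Dh, ωD z * powNorm ν (zeroExt u z - ustar z)

/-- `u` is a minimizer of `J` over the set `S`, i.e. `u ∈ argmin_{v ∈ S} J(v)`. -/
def IsArgmin {X : Type*} (J : X → ℝ) (S : Set X) (u : X) : Prop :=
  u ∈ S ∧ ∀ v ∈ S, J u ≤ J v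

end ADPINN

end

open Topology

noncomputable section

namespace ADPINN

open Filter Asymptotics

/-! ### Taylor expansions and one-dimensional Hermite interpolation -/

/-! With `αD = 0` the loss is nonnegative and sees `u` only through its jets at finitely many
distinct points. A network with the jets of the strong solution there has loss zero, so the theorem
reduces to Hermite interpolation by ridge functions `σ (w ⬝ y + b)`.

Interpolation is proved by duality (`span_ridgeJet`). Suppose a functional on jets kills every ridge
function. Taking `w = t v`, `b = a` turns it into a one-dimensional functional at the nodes `v ⬝ x
i`, with coefficients polynomial in `v`. Expanding at `t = 0`, the coefficient of `t ^ k` is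
`σ⁽ᵏ⁾(a) / k!` times its value on `X ^ k`; as `σ⁽ᵏ⁾(a) ≠ 0`, it kills all polynomials of degree at
most `n` (`scaled_functional_eq_zero`). If the `v ⬝ x i` are distinct, `hermite_functional_eq_zero`
makes the coefficients vanish at `v`. This holds off the zero set of a nonzero polynomial, hence
identically, and the functional is zero.

The number of neurons is a bound for the dimension of the jet space, by counting multi-indices. -/

theorem eq_zero_of_sum_pow_isLittleO (n : ℕ) (c : ℕ → ℝ)
    (h : (fun t : ℝ => ∑ k ∈ Finset.range (n + 1), c k * t ^ k) =o[𝓝[≠] 0] fun t => t ^ n) :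
    ∀ k ≤ n, c k = 0 := by
  induction n generalizing c with
  | zero =>
    intro k hk
    obtain rfl : k = 0 := by omega
    simpa using h
  | succ n ih =>
    have h0 : c 0 = 0 := by
      have h1 : Tendsto (fun t : ℝ => ∑ k ∈ Finset.range (n + 1 + 1), c k * t ^ k) (𝓝[≠] 0)
          (𝓝 (∑ k ∈ Finset.range (n + 1 + 1), c k * (0 : ℝ) ^ k)) :=
        (Continuous.tendsto (by fun_prop) 0).mono_left nhdsWithin_le_nhds
      have h2 : Tendsto (fun t : ℝ => t ^ (n + 1)) (𝓝[≠] 0) (𝓝 ((0 : ℝ) ^ (n + 1))) :=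
        (Continuous.tendsto (by fun_prop) 0).mono_left nhdsWithin_le_nhds
      rw [zero_pow (Nat.succ_ne_zero n)] at h2
      have h3 := tendsto_nhds_unique h1 (h.trans_tendsto h2)
      rw [Finset.sum_range_succ'] at h3
      simpa using h3
    have h4 : (fun t : ℝ => ∑ k ∈ Finset.range (n + 1), c (k + 1) * t ^ k)
        =o[𝓝[≠] 0] fun t => t ^ n := by
      have h5 := (isBigO_refl (fun t : ℝ => t⁻¹) (𝓝[≠] 0)).mul_isLittleO h
      refine h5.congr' ?_ ?_
      · filter_upwards [self_mem_nhdsWithin] with t ht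
        have ht : t ≠ 0 := ht
        rw [Finset.sum_range_succ', h0, mul_add, Finset.mul_sum]
        simp only [zero_mul, mul_zero, add_zero]
        refine Finset.sum_congr rfl fun k _ => ?_
        field_simp
        ring
      · filter_upwards [self_mem_nhdsWithin] with t ht
        have ht : t ≠ 0 := ht
        rw [pow_succ', inv_mul_cancel_left₀ ht]
    intro k hk
    cases k with
    | zero => exact h0
    | succ k => exact ih (fun k => c (k + 1)) h4 k (by omega)

theorem contDiff_iteratedDeriv {σ : ℝ → ℝ} {n m : ℕ} (hσ : ContDiff ℝ n σ) (hm : m ≤ n) :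
    ContDiff ℝ ((n - m : ℕ) : WithTop ℕ∞) (iteratedDeriv m σ) := by
  rw [iteratedDeriv_eq_iterate]
  refine ContDiff.iterate_deriv' (n - m) m ?_
  rwa [Nat.sub_add_cancel hm]

/-- Taylor expansion along a scaled argument, in powers of the scaling parameter. -/
theorem iteratedDeriv_scaled_taylor {σ : ℝ → ℝ} {n m : ℕ} (hσ : ContDiff ℝ n σ) (hm : m ≤ n)
    (a s : ℝ) :
    (fun t : ℝ => t ^ m * iteratedDeriv m σ (t * s + a) -
      ∑ k ∈ Finset.range (n + 1), (iteratedDeriv k σ a / k.factorial *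
        (Polynomial.derivative^[m] (Polynomial.X ^ k)).eval s) * t ^ k)
      =o[𝓝[≠] 0] fun t => t ^ n := by
  have h1 := taylor_isLittleO_univ (x₀ := a) (contDiff_iteratedDeriv hσ hm)
  have h2 : Tendsto (fun t : ℝ => t * s + a) (𝓝[≠] 0) (𝓝 a) := by
    have : Tendsto (fun t : ℝ => t * s + a) (𝓝 0) (𝓝 (0 * s + a)) :=
      Continuous.tendsto (by fun_prop) 0
    rw [zero_mul, zero_add] at this
    exact this.mono_left nhdsWithin_le_nhds
  have h3 := h1.comp_tendsto h2
  have h4 : (fun t : ℝ => (t * s + a - a) ^ (n - m)) =O[𝓝[≠] 0] fun t => t ^ (n - m) := by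
    refine IsBigO.of_bound (|s| ^ (n - m)) (Eventually.of_forall fun t => ?_)
    simp [mul_pow, mul_comm]
  have h5 := (isBigO_refl (fun t : ℝ => t ^ m) (𝓝[≠] 0)).mul_isLittleO (h3.trans_isBigO h4)
  refine h5.congr (fun t => ?_) (fun t => ?_)
  · simp only [Function.comp, mul_sub]
    congr 1
    rw [taylor_within_apply, Finset.mul_sum]
    -- Terms with `k < m` vanish, since the `m`-th derivative kills `X ^ k`; the rest is the Taylor
    -- polynomial of `σ⁽ᵐ⁾` shifted by `m`.
    rw [show n + 1 = m + (n - m + 1) by omega, Finset.sum_range_add _ m (n - m + 1)]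
    rw [Finset.sum_eq_zero (s := Finset.range m), zero_add]
    · refine Finset.sum_congr rfl fun k hk => ?_
      rw [iteratedDerivWithin_univ, iteratedDeriv_eq_iterate, iteratedDeriv_eq_iterate,
        iteratedDeriv_eq_iterate, ← Function.iterate_add_apply, add_comm k m,
        Polynomial.iterate_derivative_X_pow_eq_smul]
      simp only [Polynomial.eval_smul, Polynomial.eval_pow, Polynomial.eval_X, smul_eq_mul]
      have h6 := Nat.factorial_mul_descFactorial (show m ≤ m + k by omega)
      rw [Nat.add_sub_cancel_left] at h6 ⊢
      have h7 : ((m + k).factorial : ℝ) = k.factorial * (m + k).descFactorial m := by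
        exact_mod_cast h6.symm
      have h8 : (k.factorial : ℝ) ≠ 0 := by positivity
      have h9 : ((m + k).descFactorial m : ℝ) ≠ 0 := by
        intro h
        rw [h, mul_zero] at h7
        exact (by positivity : ((m + k).factorial : ℝ) ≠ 0) h7
      rw [h7]
      simp only [add_sub_cancel_right]
      field_simp
      ring
    · intro k hk
      rw [Polynomial.iterate_derivative_eq_zero]
      · simp
      · simpa using hk
  · rw [← pow_add]
    congr 1
    omega

/-- Uniqueness in one-dimensional Hermite interpolation: a functional built from derivatives at
distinct nodes that vanishes on all polynomials of degree at most `n` is trivial. -/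
theorem hermite_functional_eq_zero {ι : Type*} [Fintype ι] {s : ι → ℝ}
    (hs : Function.Injective s) (r : ι → ℕ) (p : ι → ℕ → ℝ) {n : ℕ}
    (hn : ∑ i, (r i + 1) ≤ n + 1)
    (h : ∀ g : Polynomial ℝ, g.natDegree ≤ n →
      ∑ i, ∑ m ∈ Finset.range (r i + 1),
        p i m * (Polynomial.derivative^[m] g).eval (s i) = 0) :
    ∀ i, ∀ m ≤ r i, p i m = 0 := by
  classical
  intro i
  by_contra! hcon
  obtain ⟨m₀, hm₀, hp₀⟩ := hcon
  -- Let `m` be the largest order with `p i m ≠ 0`. The test polynomial `g` vanishes to order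
  -- exactly `m` at `s i` and to order at least `r j + 1` at every other node, so only the term `p i
  -- m * g⁽ᵐ⁾(s i)` survives.
  obtain ⟨m, hm, hmax⟩ := Finset.exists_max_image
    ((Finset.range (r i + 1)).filter fun m => p i m ≠ 0) id
    ⟨m₀, Finset.mem_filter.2 ⟨Finset.mem_range.2 (by omega), hp₀⟩⟩
  rw [Finset.mem_filter, Finset.mem_range] at hm
  simp only [Finset.mem_filter, Finset.mem_range, id, and_imp] at hmax
  set q : Polynomial ℝ := ∏ j ∈ Finset.univ.erase i,
    (Polynomial.X - Polynomial.C (s j)) ^ (r j + 1) with hq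
  set g : Polynomial ℝ := (Polynomial.X - Polynomial.C (s i)) ^ m * q with hg
  have hqmon : q.Monic := Polynomial.monic_prod_of_monic _ _ fun j _ =>
    (Polynomial.monic_X_sub_C (s j)).pow _
  have hg0 : g ≠ 0 := (((Polynomial.monic_X_sub_C (s i)).pow m).mul hqmon).ne_zero
  have hqi : ¬ q.IsRoot (s i) := by
    rw [Polynomial.IsRoot, hq, Polynomial.eval_prod, Finset.prod_eq_zero_iff]
    rintro ⟨j, hj, hj0⟩
    simp only [Polynomial.eval_pow, Polynomial.eval_sub, Polynomial.eval_X,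
      Polynomial.eval_C] at hj0
    exact (Finset.mem_erase.1 hj).1 (hs (sub_eq_zero.1 (pow_eq_zero_iff (by omega) |>.1 hj0))).symm
  have hmult : g.rootMultiplicity (s i) = m := by
    rw [hg, Polynomial.rootMultiplicity_mul hg0, Polynomial.rootMultiplicity_X_sub_C_pow,
      Polynomial.rootMultiplicity_eq_zero hqi, add_zero]
  have hdeg : g.natDegree ≤ n := by
    have h1 : q.natDegree ≤ ∑ j ∈ Finset.univ.erase i, (r j + 1) := by
      refine (Polynomial.natDegree_prod_le _ _).trans (Finset.sum_le_sum fun j _ => ?_)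
      refine Polynomial.natDegree_pow_le.trans ?_
      simp
    have h2 : g.natDegree ≤ m + q.natDegree := by
      refine Polynomial.natDegree_mul_le.trans (Nat.add_le_add_right ?_ _)
      refine Polynomial.natDegree_pow_le.trans ?_
      simp
    have h3 := Finset.add_sum_erase Finset.univ (fun j => r j + 1) (Finset.mem_univ i)
    omega
  have h1 := h g hdeg
  rw [Finset.sum_eq_single i, Finset.sum_eq_single m] at h1
  · refine hm.2 ((mul_eq_zero.1 h1).resolve_right fun h2 => ?_)
    have h3 : m < g.rootMultiplicity (s i) := by
      rw [Polynomial.lt_rootMultiplicity_iff_isRoot_iterate_derivative hg0]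
      intro k hk
      rcases hk.lt_or_eq with hk | rfl
      · exact Polynomial.isRoot_iterate_derivative_of_lt_rootMultiplicity (by omega)
      · exact h2
    omega
  · intro k hk hkm
    by_cases hpk : p i k = 0
    · rw [hpk, zero_mul]
    have h2 := hmax k (Finset.mem_range.1 hk) hpk
    have h3 : (Polynomial.derivative^[k] g).IsRoot (s i) :=
      Polynomial.isRoot_iterate_derivative_of_lt_rootMultiplicity (by omega)
    rw [h3.eq_zero, mul_zero]
  · intro h2
    exact absurd (Finset.mem_range.2 hm.1) h2
  · intro j _ hj
    refine Finset.sum_eq_zero fun k hk => ?_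
    have h2 : r j + 1 ≤ g.rootMultiplicity (s j) := by
      rw [Polynomial.le_rootMultiplicity_iff hg0]
      refine Dvd.dvd.mul_left (Finset.dvd_prod_of_mem
        (fun j => (Polynomial.X - Polynomial.C (s j)) ^ (r j + 1))
        (Finset.mem_erase.2 ⟨hj, Finset.mem_univ j⟩)) _
    have h3 : (Polynomial.derivative^[k] g).IsRoot (s j) :=
      Polynomial.isRoot_iterate_derivative_of_lt_rootMultiplicity
        ((Finset.mem_range.1 hk).trans_le h2)
    rw [h3.eq_zero, mul_zero]
  · intro h2
    exact absurd (Finset.mem_univ i) h2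

/-- Derivatives of scaled translates of an activation with nonvanishing derivatives at `a` separate
derivative functionals supported at finitely many distinct nodes. -/
theorem scaled_functional_eq_zero {ι : Type*} [Fintype ι] {s : ι → ℝ}
    (hs : Function.Injective s) (r : ι → ℕ) (p : ι → ℕ → ℝ) {n : ℕ}
    (hn : ∑ i, (r i + 1) ≤ n + 1) {σ : ℝ → ℝ} (hσ : ContDiff ℝ n σ) {a : ℝ}
    (ha : ∀ k ≤ n, iteratedDeriv k σ a ≠ 0)
    (h : ∀ t : ℝ, ∑ i, ∑ m ∈ Finset.range (r i + 1),
      p i m * (t ^ m * iteratedDeriv m σ (t * s i + a)) = 0) :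
    ∀ i, ∀ m ≤ r i, p i m = 0 := by
  have hrn : ∀ i, ∀ m ∈ Finset.range (r i + 1), m ≤ n := by
    intro i m hm
    have h1 := Finset.single_le_sum (f := fun i => r i + 1) (fun _ _ => Nat.zero_le _)
      (Finset.mem_univ i)
    have h2 := Finset.mem_range.1 hm
    omega
  let L : Polynomial ℝ →ₗ[ℝ] ℝ := ∑ i, ∑ m ∈ Finset.range (r i + 1),
    p i m • ((Polynomial.leval (s i)).comp (Polynomial.derivative ^ m))
  have hL : ∀ g, L g = ∑ i, ∑ m ∈ Finset.range (r i + 1),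
      p i m * (Polynomial.derivative^[m] g).eval (s i) := by
    intro g
    simp [L, LinearMap.sum_apply, Module.End.pow_apply]
  -- The combination of the scaled derivatives is zero for every `t`, so its Taylor polynomial in
  -- `t` is `o(t ^ n)` and each coefficient vanishes.
  have hX : ∀ k ≤ n, L (Polynomial.X ^ k) = 0 := by
    have h1 := eq_zero_of_sum_pow_isLittleO n
      (fun k => iteratedDeriv k σ a / k.factorial * L (Polynomial.X ^ k)) ?_
    · intro k hk
      refine (mul_eq_zero.1 (h1 k hk)).resolve_left ?_
      exact div_ne_zero (ha k hk) (by positivity)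
    · have h2 := IsLittleO.sum (s := Finset.univ) fun i _ =>
        IsLittleO.sum (s := Finset.range (r i + 1)) fun m hm =>
          (iteratedDeriv_scaled_taylor hσ (hrn i m hm) a (s i)).const_mul_left (p i m)
      rw [← isLittleO_neg_left]
      refine h2.congr_left fun t => ?_
      simp only [Finset.sum_apply, mul_sub, Finset.sum_sub_distrib]
      rw [h t, zero_sub, neg_inj]
      simp only [hL, Finset.mul_sum, Finset.sum_mul]
      rw [Finset.sum_comm' (t' := Finset.univ) (s' := fun _ => Finset.range (n + 1))
        (by simp)]
      refine Finset.sum_congr rfl fun i _ => ?_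
      rw [Finset.sum_comm]
      refine Finset.sum_congr rfl fun m _ => Finset.sum_congr rfl fun k _ => ?_
      ring
  refine hermite_functional_eq_zero hs r p hn fun g hg => ?_
  rw [← hL, g.as_sum_range' (n + 1) (by omega), map_sum]
  refine Finset.sum_eq_zero fun k hk => ?_
  rw [← Polynomial.C_mul_X_pow_eq_monomial, ← Polynomial.smul_eq_C_mul, map_smul,
    hX k (by simpa [Nat.lt_succ_iff] using hk), smul_zero]

/-! ### Counting multi-indices -/

/-- The slack `r - |β|`, added as an extra coordinate, turns `β` into a weak composition of `r` into
`d + 1` parts. -/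
theorem multiIndex_finite_and_card (d r : ℕ) :
    Finite (MultiIndex d r) ∧ Nat.card (MultiIndex d r) ≤ (d + r).choose d := by
  let φ : MultiIndex d r → (Finset.univ : Finset (Fin (d + 1))).finsuppAntidiag r := fun β =>
    ⟨Finsupp.equivFunOnFinite.symm (Fin.cons (r - ∑ i, β.1 i) β.1), by
      have := β.2
      simp only [Finset.mem_finsuppAntidiag, Fin.sum_univ_succ, Finsupp.coe_equivFunOnFinite_symm,
        Fin.cons_zero, Fin.cons_succ, Finset.subset_univ, and_true]
      omega⟩
  have hφ : Function.Injective φ := by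
    intro β γ h
    have h1 := Finsupp.equivFunOnFinite.symm.injective (Subtype.ext_iff.1 h)
    exact Subtype.ext (Fin.cons_injective2 h1).2
  refine ⟨Finite.of_injective φ hφ, (Nat.card_le_card_of_injective φ hφ).trans ?_⟩
  rw [Nat.card_eq_fintype_card, Fintype.card_coe, Finset.card_finsuppAntidiag_nat_eq_multichoose,
    Nat.multichoose_eq, Finset.card_univ, Fintype.card_fin, Nat.choose_symm_of_eq_add]
  · exact le_of_eq (by congr 1; omega)
  · omega

instance (d r : ℕ) : Fintype (MultiIndex d r) :=
  @Fintype.ofFinite _ (multiIndex_finite_and_card d r).1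

theorem card_multiIndex_le (d r : ℕ) : Fintype.card (MultiIndex d r) ≤ (d + r).choose d := by
  rw [← Nat.card_eq_fintype_card]
  exact (multiIndex_finite_and_card d r).2

/-- These are two terms of Vandermonde's sum, distinct because `d > 0`. -/
theorem choose_add_choose_le {d : ℕ} (hd : 0 < d) (m n : ℕ) :
    m.choose d + n.choose d ≤ (m + n).choose d := by
  rw [Nat.add_choose_eq]
  have h := Finset.sum_le_sum_of_subset (f := fun ij : ℕ × ℕ => m.choose ij.1 * n.choose ij.2)
    (show ({(d, 0), (0, d)} : Finset (ℕ × ℕ)) ⊆ Finset.HasAntidiagonal.antidiagonal d by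
      intro x hx
      simp only [Finset.mem_insert, Finset.mem_singleton] at hx
      rcases hx with rfl | rfl <;> simp)
  rw [Finset.sum_pair (by simp; omega)] at h
  simpa using h

theorem mul_choose_le {d : ℕ} (hd : 0 < d) (N m : ℕ) : N * m.choose d ≤ (N * m).choose d := by
  induction N with
  | zero => simp
  | succ N ih =>
    rw [Nat.succ_mul, Nat.succ_mul]
    exact (Nat.add_le_add_right ih _).trans (choose_add_choose_le hd _ _)

/-! ### Jets of ridge functions span all jets -/

/-- The coefficient polynomial of the `m`-th derivative in a functional on jets applied to ridge
functions, as a polynomial in the direction. -/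
def jetSymbol {d r : ℕ} (lam : MultiIndex d r → ℝ) (m : ℕ) : MvPolynomial (Fin d) ℝ :=
  ∑ β : MultiIndex d r, if ∑ k, β.1 k = m then
    MvPolynomial.monomial (Finsupp.equivFunOnFinite.symm β.1) (lam β) else 0

theorem coeff_jetSymbol {d r : ℕ} (lam : MultiIndex d r → ℝ) (β : MultiIndex d r) :
    (jetSymbol lam (∑ k, β.1 k)).coeff (Finsupp.equivFunOnFinite.symm β.1) = lam β := by
  classical
  rw [jetSymbol, MvPolynomial.coeff_sum, Finset.sum_eq_single β]
  · simp
  · intro γ _ hγ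
    split_ifs
    · rw [MvPolynomial.coeff_monomial, if_neg]
      exact fun h => hγ (Subtype.ext (Finsupp.equivFunOnFinite.symm.injective h))
    · simp
  · simp

/-- Grouping multi-indices by order reduces a jet functional on ridge functions of direction `v` to
a one-dimensional one. -/
theorem sum_jetSymbol_eval {d r : ℕ} (lam : MultiIndex d r → ℝ) (v : Fin d → ℝ) (f : ℕ → ℝ) :
    ∑ m ∈ Finset.range (r + 1), MvPolynomial.eval v (jetSymbol lam m) * f m =
      ∑ β : MultiIndex d r, lam β * ((∏ k, v k ^ β.1 k) * f (∑ k, β.1 k)) := by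
  simp only [jetSymbol, map_sum, Finset.sum_mul]
  rw [Finset.sum_comm]
  refine Finset.sum_congr rfl fun β _ => ?_
  rw [Finset.sum_eq_single (∑ k, β.1 k)]
  · rw [if_pos rfl, MvPolynomial.eval_monomial, Finsupp.prod_fintype _ _ (by simp), mul_assoc]
    simp
  · intro m _ hm
    rw [if_neg hm.symm]
    simp
  · intro h
    exact absurd (Finset.mem_range.2 (Nat.lt_succ_of_le β.2)) h

/-- Take the product of the nonzero linear forms `v ⬝ (x i - x j)` over `i ≠ j`. -/
theorem exists_separating_polynomial {ι : Type*} [Fintype ι] {d : ℕ} {x : ι → Fin d → ℝ}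
    (hx : Function.Injective x) :
    ∃ D : MvPolynomial (Fin d) ℝ, D ≠ 0 ∧ ∀ v, MvPolynomial.eval v D ≠ 0 →
      Function.Injective fun i => v ⬝ᵥ x i := by
  classical
  let L : ι × ι → MvPolynomial (Fin d) ℝ := fun p =>
    ∑ k, MvPolynomial.C (x p.1 k - x p.2 k) * MvPolynomial.X k
  have hL : ∀ p v, MvPolynomial.eval v (L p) = v ⬝ᵥ x p.1 - v ⬝ᵥ x p.2 := by
    intro p v
    simp only [L, map_sum, map_mul, MvPolynomial.eval_C, MvPolynomial.eval_X, dotProduct,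
      ← Finset.sum_sub_distrib]
    exact Finset.sum_congr rfl fun k _ => by ring
  refine ⟨∏ p ∈ (Finset.univ : Finset ι).offDiag, L p, ?_, ?_⟩
  · rw [Finset.prod_ne_zero_iff]
    intro p hp h0
    refine (Finset.mem_offDiag.1 hp).2.2 (hx (funext fun k => ?_))
    have h1 := hL p (Pi.single k 1)
    rw [h0, map_zero] at h1
    simp only [single_dotProduct, one_mul] at h1
    linarith
  · intro v hv i j hij
    by_contra hne
    rw [map_prod, Finset.prod_ne_zero_iff] at hv
    refine hv (i, j) (by simpa using hne) ?_
    rw [hL]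
    exact sub_eq_zero.2 hij

/-- The jets at the nodes `x i` of the ridge function `y ↦ σ (w ⬝ y + b)`. -/
def ridgeJet {ι : Type*} {d : ℕ} (σ : ℝ → ℝ) (x : ι → Fin d → ℝ) (r : ι → ℕ)
    (q : (Fin d → ℝ) × ℝ) : (Σ i, MultiIndex d (r i)) → ℝ :=
  fun p => (∏ k, q.1 k ^ p.2.1 k) * iteratedDeriv (∑ k, p.2.1 k) σ (q.1 ⬝ᵥ x p.1 + q.2)

theorem span_ridgeJet {ι : Type*} [Fintype ι] {d : ℕ} {x : ι → Fin d → ℝ}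
    (hx : Function.Injective x) (r : ι → ℕ) {n : ℕ} (hn : ∑ i, (r i + 1) ≤ n + 1)
    {σ : ℝ → ℝ} (hσ : ContDiff ℝ n σ) {a : ℝ} (ha : ∀ k ≤ n, iteratedDeriv k σ a ≠ 0) :
    Submodule.span ℝ (Set.range (ridgeJet σ x r)) = ⊤ := by
  classical
  by_contra hspan
  obtain ⟨f, hf, hle⟩ := Submodule.exists_le_ker_of_lt_top _ (lt_top_iff_ne_top.2 hspan)
  let lam : (i : ι) → MultiIndex d (r i) → ℝ := fun i β => f (Pi.single ⟨i, β⟩ 1)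
  have hfv : ∀ v, f v = ∑ i, ∑ β, lam i β * v ⟨i, β⟩ := by
    intro v
    rw [LinearMap.pi_apply_eq_sum_univ f v, Fintype.sum_sigma]
    refine Finset.sum_congr rfl fun i _ => Finset.sum_congr rfl fun β _ => ?_
    rw [smul_eq_mul, mul_comm]
    congr 2
    funext j
    simp [Pi.single_apply, eq_comm]
  have hlam : ∀ i β, lam i β = 0 := by
    obtain ⟨D, hD, hDinj⟩ := exists_separating_polynomial hx
    have hP : ∀ i, ∀ m ≤ r i, jetSymbol (lam i) m = 0 := by
      intro i m hm
      -- The symbol is known to vanish only where `D ≠ 0`; its product with `D` vanishes everywhere,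
      -- and `D` cancels.
      refine (mul_eq_zero.1 (MvPolynomial.funext (p := jetSymbol (lam i) m * D) (q := 0)
        fun v => ?_)).resolve_right hD
      rw [map_mul, map_zero]
      by_cases hv : MvPolynomial.eval v D = 0
      · rw [hv, mul_zero]
      rw [scaled_functional_eq_zero (hDinj v hv) r
        (fun i m => MvPolynomial.eval v (jetSymbol (lam i) m)) hn hσ ha ?_ i m hm, zero_mul]
      intro t
      have h1 : f (ridgeJet σ x r (t • v, a)) = 0 :=
        hle (Submodule.subset_span (Set.mem_range_self _))
      rw [hfv] at h1
      rw [← h1]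
      refine Finset.sum_congr rfl fun i _ => ?_
      rw [sum_jetSymbol_eval (lam i) v
        (fun m => t ^ m * iteratedDeriv m σ (t * (v ⬝ᵥ x i) + a))]
      refine Finset.sum_congr rfl fun β _ => ?_
      simp only [ridgeJet, Pi.smul_apply, smul_eq_mul, mul_pow, Finset.prod_mul_distrib,
        Finset.prod_pow_eq_pow_sum, smul_dotProduct]
      ring
    intro i β
    rw [← coeff_jetSymbol (lam i) β, hP i _ β.2, MvPolynomial.coeff_zero]
  refine hf (LinearMap.ext fun v => ?_)
  rw [hfv]
  simp [hlam]

/-- A spanning set contains a spanning family indexed by any type `Fin m` with `m` at least the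
dimension. -/
theorem exists_fin_family_span_eq_top {V X : Type*} [AddCommGroup V] [Module ℝ V]
    [FiniteDimensional ℝ V] [Nonempty X] (g : X → V)
    (hg : Submodule.span ℝ (Set.range g) = ⊤) {m : ℕ} (hm : Module.finrank ℝ V ≤ m) :
    ∃ q : Fin m → X, Submodule.span ℝ (Set.range fun j => g (q j)) = ⊤ := by
  classical
  obtain ⟨f, hf, hspan, -⟩ := Submodule.exists_fun_fin_finrank_span_eq ℝ (Set.range g)
  choose y hy using hf
  have hle : Module.finrank ℝ (Submodule.span ℝ (Set.range g)) ≤ m := by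
    rwa [hg, finrank_top]
  -- Surplus indices receive an arbitrary element, which cannot shrink the span.
  refine ⟨fun j => if h : (j : ℕ) < Module.finrank ℝ (Submodule.span ℝ (Set.range g)) then
    y ⟨j, h⟩ else Classical.arbitrary X, ?_⟩
  rw [eq_top_iff]
  refine (hg.symm.trans hspan.symm).le.trans (Submodule.span_mono ?_)
  rintro _ ⟨j, rfl⟩
  refine ⟨⟨j, j.2.trans_le hle⟩, ?_⟩
  simp [hy]

/-- Hermite interpolation of arbitrary jets at distinct nodes by ridge functions. -/
theorem exists_ridge_interpolation {ι : Type*} [Fintype ι] {d c : ℕ} {x : ι → Fin d → ℝ}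
    (hx : Function.Injective x) (r : ι → ℕ) {n m : ℕ} (hn : ∑ i, (r i + 1) ≤ n + 1)
    (hm : ∑ i, (d + r i).choose d ≤ m)
    {σ : ℝ → ℝ} (hσ : ContDiff ℝ n σ) {a : ℝ} (ha : ∀ k ≤ n, iteratedDeriv k σ a ≠ 0)
    (T : (i : ι) → MultiIndex d (r i) → Fin c → ℝ) :
    ∃ (w : Fin m → Fin d → ℝ) (b : Fin m → ℝ) (C : Fin c → Fin m → ℝ),
      ∀ i (β : MultiIndex d (r i)) e, ∑ j, C e j * (∏ k, w j k ^ β.1 k) *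
        iteratedDeriv (∑ k, β.1 k) σ (w j ⬝ᵥ x i + b j) = T i β e := by
  obtain ⟨q, hq⟩ := exists_fin_family_span_eq_top (ridgeJet σ x r) (span_ridgeJet hx r hn hσ ha)
    (m := m) (by
      rw [Module.finrank_fintype_fun_eq_card, Fintype.card_sigma]
      exact (Finset.sum_le_sum fun i _ => card_multiIndex_le d (r i)).trans hm)
  -- The same neurons serve every output component; only the outer weights depend on `e`.
  have h1 : ∀ e, ∃ C : Fin m → ℝ, ∑ j, C j • ridgeJet σ x r (q j) = fun p => T p.1 p.2 e := by
    intro e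
    rw [← Submodule.mem_span_range_iff_exists_fun ℝ, hq]
    trivial
  choose C hC using h1
  refine ⟨fun j => (q j).1, fun j => (q j).2, C, fun i β e => ?_⟩
  have h2 := congrFun (hC e) ⟨i, β⟩
  rw [Finset.sum_apply] at h2
  rw [← h2]
  refine Finset.sum_congr rfl fun j _ => ?_
  simp [ridgeJet, mul_assoc]

/-! ### Partial derivatives of shallow networks -/

/-- The combination `y ↦ ∑ j, C e j * σ⁽ᵐ⁾ (w j ⬝ y + b j)` of ridge functions. -/
def ridgeSum {d c K : ℕ} (σ : ℝ → ℝ) (w : Fin K → Fin d → ℝ) (b : Fin K → ℝ)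
    (C : Fin c → Fin K → ℝ) (m : ℕ) : E d → Fin c → ℝ :=
  fun x e => ∑ j, C e j * iteratedDeriv m σ (w j ⬝ᵥ (x : Fin d → ℝ) + b j)

section ridgeSum

variable {d c K n m : ℕ} {σ : ℝ → ℝ} (w : Fin K → Fin d → ℝ) (b : Fin K → ℝ)
  (C : Fin c → Fin K → ℝ)

theorem partialDeriv_ridgeSum (hσ : ContDiff ℝ n σ) (hm : m < n) (i : Fin d) :
    partialDeriv i (ridgeSum σ w b C m) =
      ridgeSum σ w b (fun e j => C e j * w j i) (m + 1) := by
  funext x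
  refine HasLineDerivAt.lineDeriv (hasDerivAt_pi.2 fun e => ?_)
  refine HasDerivAt.fun_sum fun j _ => ?_
  rw [mul_assoc]
  refine HasDerivAt.const_mul _ ?_
  have h1 : HasDerivAt (iteratedDeriv m σ)
      (iteratedDeriv (m + 1) σ (w j ⬝ᵥ (x : Fin d → ℝ) + b j))
      (0 * w j i + (w j ⬝ᵥ (x : Fin d → ℝ) + b j)) := by
    rw [zero_mul, zero_add, iteratedDeriv_succ]
    exact (hσ.differentiable_iteratedDeriv m (by exact_mod_cast hm) _).hasDerivAt
  have h2 : HasDerivAt (fun t : ℝ => t * w j i + (w j ⬝ᵥ (x : Fin d → ℝ) + b j)) (w j i) 0 := by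
    simpa using ((hasDerivAt_id (0 : ℝ)).mul_const (w j i)).add_const
      (w j ⬝ᵥ (x : Fin d → ℝ) + b j)
  have h3 := h1.comp (0 : ℝ) h2
  rw [mul_comm] at h3
  refine h3.congr_of_eventuallyEq (Eventually.of_forall fun t => ?_)
  simp only [Function.comp]
  congr 1
  simp [dotProduct_add, dotProduct_smul]
  ring

theorem partialDeriv_iterate_ridgeSum (hσ : ContDiff ℝ n σ) (i : Fin d) (k : ℕ)
    (hm : m + k ≤ n) :
    (partialDeriv i)^[k] (ridgeSum σ w b C m) =
      ridgeSum σ w b (fun e j => C e j * w j i ^ k) (m + k) := by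
  induction k with
  | zero => simp
  | succ k ih =>
    rw [Function.iterate_succ_apply', ih (by omega), partialDeriv_ridgeSum w b _ hσ (by omega)]
    simp only [mul_assoc, ← pow_succ, add_assoc]

theorem multiDeriv_ridgeSum (hσ : ContDiff ℝ n σ) (β : Fin d → ℕ) (hβ : ∑ i, β i ≤ n) :
    multiDeriv β (ridgeSum σ w b C 0) =
      ridgeSum σ w b (fun e j => C e j * ∏ i, w j i ^ β i) (∑ i, β i) := by
  have key : ∀ l : List (Fin d), (l.map β).sum ≤ n →
      l.foldr (fun i g => (partialDeriv i)^[β i] g) (ridgeSum σ w b C 0) =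
        ridgeSum σ w b (fun e j => C e j * (l.map fun i => w j i ^ β i).prod)
          (l.map β).sum := by
    intro l
    induction l with
    | nil => simp
    | cons i l ih =>
      intro hl
      rw [List.map_cons, List.sum_cons] at hl
      rw [List.foldr_cons, ih (by omega),
        partialDeriv_iterate_ridgeSum w b _ hσ i (β i) (by omega)]
      simp only [List.map_cons, List.sum_cons, List.prod_cons, mul_assoc, add_comm,
        mul_comm (w _ i ^ β i)]
  have h := key (List.finRange d) (by rwa [← List.ofFn_eq_map, List.sum_ofFn])
  simp only [← List.ofFn_eq_map, List.sum_ofFn, List.prod_ofFn] at h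
  exact h

theorem continuous_ridgeSum (hσ : ContDiff ℝ n σ) (hm : m ≤ n) :
    Continuous (ridgeSum σ w b C m) := by
  have h := hσ.continuous_iteratedDeriv m (by exact_mod_cast hm)
  refine continuous_pi fun e => continuous_finsetSum _ fun j _ =>
    continuous_const.mul (h.comp ?_)
  simp only [dotProduct]
  fun_prop

end ridgeSum

/-! ### Jets of restrictions of global functions -/

theorem partialDeriv_eqOn {d c : ℕ} {Ω : Set (E d)} (hΩ : IsOpen Ω) {f g : E d → Fin c → ℝ}
    (h : Set.EqOn f g Ω) (i : Fin d) : Set.EqOn (partialDeriv i f) (partialDeriv i g) Ω :=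
  fun _ hx => (h.eventuallyEq_of_mem (hΩ.mem_nhds hx)).lineDeriv_eq

theorem multiDeriv_eqOn {d c : ℕ} {Ω : Set (E d)} (hΩ : IsOpen Ω) {f g : E d → Fin c → ℝ}
    (h : Set.EqOn f g Ω) (β : Fin d → ℕ) : Set.EqOn (multiDeriv β f) (multiDeriv β g) Ω := by
  have key : ∀ (i : Fin d) (k : ℕ) {f g : E d → Fin c → ℝ}, Set.EqOn f g Ω →
      Set.EqOn ((partialDeriv i)^[k] f) ((partialDeriv i)^[k] g) Ω := by
    intro i k
    induction k with
    | zero => exact fun h => h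
    | succ k ih => exact fun h => ih (partialDeriv_eqOn hΩ h i)
  unfold multiDeriv
  induction List.finRange d with
  | nil => exact h
  | cons i l ih => exact key i _ ih

theorem zeroExt_restrict_eqOn {d c : ℕ} {Ω : Set (E d)} (f : E d → Fin c → ℝ) :
    Set.EqOn (zeroExt fun x : closure Ω => f x) f Ω := fun x hx =>
  Subtype.val_injective.extend_apply (fun x : closure Ω => f x) _ ⟨x, subset_closure hx⟩

theorem interiorJet_restrict {d c r : ℕ} {Ω : Set (E d)} (hΩ : IsOpen Ω) (f : E d → Fin c → ℝ)
    {z : E d} (hz : z ∈ Ω) (β : MultiIndex d r) :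
    interiorJet r (fun x : closure Ω => f x) z β = multiDeriv β.1 f z :=
  multiDeriv_eqOn hΩ (zeroExt_restrict_eqOn f) β.1 hz

/-- A derivative continuous on the whole space has its own value as trace. -/
theorem boundaryJet_restrict {d c r : ℕ} {Ω : Set (E d)} (hΩ : IsOpen Ω) (f : E d → Fin c → ℝ)
    {z : E d} (hz : z ∈ closure Ω) (β : MultiIndex d r) (hf : Continuous (multiDeriv β.1 f)) :
    boundaryJet r (fun x : closure Ω => f x) z β = multiDeriv β.1 f z := by
  refine extendFrom_eq hz ?_
  refine ((hf.tendsto z).mono_left nhdsWithin_le_nhds).congr' ?_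
  filter_upwards [self_mem_nhdsWithin] with x hx
  exact (multiDeriv_eqOn hΩ (zeroExt_restrict_eqOn f) β.1 hx).symm

/-- Shallow networks realize prescribed jets at finitely many interior and boundary points. -/
theorem exists_network_matching_jets {d c : ℕ} (hd : 0 < d) (hc : 0 < c) {Ω : Set (E d)}
    (hΩ : IsOpen Ω) (rF rB : ℕ) (Ωh Γh : Finset (E d)) (hΩh : (Ωh : Set (E d)) ⊆ Ω)
    (hΓh : (Γh : Set (E d)) ⊆ frontier Ω) (hne : Ωh.Nonempty)
    {ℓ M : ℕ} (hℓ : ℓ = Ωh.card * (d + rF) + Γh.card * (d + rB))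
    (hM : M = c * ℓ.choose d * (d + 1) + c * (c * ℓ.choose d + 1))
    {σ : ℝ → ℝ} (hσ : ContDiff ℝ ((ℓ - d : ℕ) : WithTop ℕ∞) σ)
    {a : ℝ} (ha : ∀ k : ℕ, k ≤ ℓ - d → iteratedDeriv k σ a ≠ 0) (v : closure Ω → Fin c → ℝ) :
    ∃ u ∈ netClassParams Ω c σ 2 M, (∀ z ∈ Ωh, interiorJet rF u z = interiorJet rF v z) ∧
      ∀ z ∈ Γh, boundaryJet rB u z = boundaryJet rB v z := by
  let pt : Ωh ⊕ Γh → E d := Sum.elim (fun z => z.1) (fun z => z.1)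
  let r : Ωh ⊕ Γh → ℕ := Sum.elim (fun _ => rF) (fun _ => rB)
  -- An open set misses its frontier, so all nodes are distinct.
  have hdisj : ∀ z ∈ Ωh, z ∉ Γh := fun z h1 h2 =>
    Set.eq_empty_iff_forall_notMem.1 hΩ.inter_frontier_eq z ⟨hΩh h1, hΓh h2⟩
  have hpt : Function.Injective fun i => (pt i : Fin d → ℝ) := by
    have h1 : Function.Injective pt := Subtype.val_injective.sumElim Subtype.val_injective
      fun z y h => hdisj z z.2 (h ▸ y.2)
    exact fun i j h => h1 (PiLp.ext fun k => congrFun h k)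
  have hΩpos : 0 < Ωh.card := hne.card_pos
  have hdℓ : d ≤ ℓ := by
    rw [hℓ]
    nlinarith [Nat.zero_le (Γh.card * (d + rB))]
  -- The slack is `(d - 1) (N_F + N_B - 1)`, nonnegative because `d ≥ 1` and `Ωh` is nonempty.
  have hn : ∑ i, (r i + 1) ≤ ℓ - d + 1 := by
    simp only [r, Fintype.sum_sum_type, Sum.elim_inl, Sum.elim_inr, Finset.sum_const,
      Finset.card_univ, Fintype.card_coe, smul_eq_mul]
    have h1 : d + (Ωh.card * (rF + 1) + Γh.card * (rB + 1)) ≤ ℓ + 1 := by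
      obtain ⟨d, rfl⟩ : ∃ k, d = k + 1 := ⟨d - 1, by omega⟩
      obtain ⟨N, hN⟩ : ∃ k, Ωh.card = k + 1 := ⟨Ωh.card - 1, by omega⟩
      rw [hℓ, hN]
      nlinarith [Nat.zero_le (N * d), Nat.zero_le (Γh.card * d)]
    omega
  -- Already `ℓ.choose d` neurons suffice; the factor `c` only pads the width to match `M`.
  have hm : ∑ i, (d + r i).choose d ≤ c * ℓ.choose d := by
    simp only [r, Fintype.sum_sum_type, Sum.elim_inl, Sum.elim_inr, Finset.sum_const,
      Finset.card_univ, Fintype.card_coe, smul_eq_mul]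
    refine le_trans ?_ (Nat.le_mul_of_pos_left _ hc)
    rw [hℓ]
    exact (Nat.add_le_add (mul_choose_le hd _ _) (mul_choose_le hd _ _)).trans
      (choose_add_choose_le hd _ _)
  obtain ⟨w, b, C, hC⟩ := exists_ridge_interpolation hpt r hn hm hσ ha
    (fun i => match i with
      | Sum.inl z => fun β => interiorJet rF v z β
      | Sum.inr z => fun β => boundaryJet rB v z β)
  have hr : ∀ i, r i ≤ ℓ - d := by
    intro i
    have h1 := Finset.single_le_sum (f := fun i => r i + 1) (fun _ _ => Nat.zero_le _)
      (Finset.mem_univ i)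
    omega
  have hjet : ∀ i (β : MultiIndex d (r i)) e, multiDeriv β.1 (ridgeSum σ w b C 0) (pt i) e =
      ∑ j, C e j * (∏ k, w j k ^ β.1 k) *
        iteratedDeriv (∑ k, β.1 k) σ (w j ⬝ᵥ (pt i : Fin d → ℝ) + b j) := by
    intro i β e
    rw [multiDeriv_ridgeSum w b C hσ β.1 (β.2.trans (hr i))]
    rfl
  refine ⟨fun x => ridgeSum σ w b C 0 x, ⟨.hidden (m := c * ℓ.choose d)
    (Nat.mul_pos hc (Nat.choose_pos hdℓ)) (Matrix.of w) b (.output (Matrix.of C) 0), ?_, ?_⟩,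
    fun z hz => ?_, fun z hz => ?_⟩
  · rw [hM]
    rfl
  · intro x
    funext e
    simp only [ridgeSum, iteratedDeriv_zero, Net.eval, add_zero]
    rfl
  · funext β
    rw [interiorJet_restrict hΩ _ (hΩh hz)]
    funext e
    exact (hjet (Sum.inl ⟨z, hz⟩) β e).trans (hC (Sum.inl ⟨z, hz⟩) β e)
  · funext β
    have hβ : ∑ i, β.1 i ≤ ℓ - d := β.2.trans (hr (Sum.inr ⟨z, hz⟩))
    rw [boundaryJet_restrict hΩ _ (frontier_subset_closure (hΓh hz)) β (by
      rw [multiDeriv_ridgeSum w b C hσ β.1 hβ]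
      exact continuous_ridgeSum w b _ hσ hβ)]
    funext e
    exact (hjet (Sum.inr ⟨z, hz⟩) β e).trans (hC (Sum.inr ⟨z, hz⟩) β e)

/-! ### The loss -/

theorem powNorm_nonneg {n : ℕ} (ν : ℝ) (y : Fin n → ℝ) : 0 ≤ powNorm ν y :=
  Finset.sum_nonneg fun _ _ => Real.rpow_nonneg (abs_nonneg _) _

theorem powNorm_zero {n : ℕ} {ν : ℝ} (hν : ν ≠ 0) : powNorm ν (0 : Fin n → ℝ) = 0 := by
  simp [powNorm, Real.zero_rpow hν]

end ADPINN

end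

/-! ### Existence of a minimizer with zero loss -/

theorem mainTheorem3
    {d c cF cB : ℕ} (hd : 0 < d) (hc : 0 < c)
    -- the domain and the part of the boundary that carries boundary conditions
    (Ω Γ : Set (ADPINN.E d)) (hΩ : IsOpen Ω) (hΓ : Γ ⊆ frontier Ω)
    -- the solution space
    (rF rB : ℕ) (U : Set (closure Ω → Fin c → ℝ))
    (hU : U ⊆ ADPINN.ContDiffInterior Ω c rF ∩ ADPINN.ContDiffClosure Ω c rB)
    -- the interior and boundary differential operators, with their local expressions
    (opF : U → Ω → Fin cF → ℝ) (opB : U → Γ → Fin cB → ℝ)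
    (F : ADPINN.E d → (ADPINN.MultiIndex d rF → Fin c → ℝ) → Fin cF → ℝ)
    (B : ADPINN.E d → (ADPINN.MultiIndex d rB → Fin c → ℝ) → Fin cB → ℝ)
    (hF : ∀ (u : U) (z : Ω), opF u z = F z (ADPINN.interiorJet rF u.1 z))
    (hB : ∀ (u : U) (z : Γ), opB u z = B z (ADPINN.boundaryJet rB u.1 z))
    -- collocation points and data locations
    (Ωh Γh Dh : Finset (ADPINN.E d)) (hΩh : (Ωh : Set (ADPINN.E d)) ⊆ Ω)
    (hΓh : (Γh : Set (ADPINN.E d)) ⊆ Γ) (hΩh_ne : Ωh.Nonempty) (hΓh_ne : Γh.Nonempty)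
    (hDh : (Dh : Set (ADPINN.E d)) ⊆ (Ωh : Set (ADPINN.E d)) ∪ (Γh : Set (ADPINN.E d)))
    (ustar : ADPINN.E d → Fin c → ℝ)
    -- weights and exponent of the loss
    (ωF ωB ωD : ADPINN.E d → ℝ) (hωF : ∀ z ∈ Ωh, 0 ≤ ωF z) (hωB : ∀ z ∈ Γh, 0 ≤ ωB z)
    (αF αB αD ν : ℝ) (hαF : 0 ≤ αF) (hαB : 0 ≤ αB) (hαD : αD = 0) (hν : 1 ≤ ν)
    -- the network class
    (ℓ M : ℕ) (hℓ : ℓ = Ωh.card * (d + rF) + Γh.card * (d + rB))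
    (hM : M = c * ℓ.choose d * (d + 1) + c * (c * ℓ.choose d + 1))
    (σ : ℝ → ℝ) (hσ : ContDiff ℝ ((ℓ - d : ℕ) : WithTop ℕ∞) σ)
    (a : ℝ) (ha : ∀ k : ℕ, k ≤ ℓ - d → iteratedDeriv k σ a ≠ 0)
    -- a strong solution of the boundary value problem
    (uhat : U) (hsolF : ∀ z : Ω, opF uhat z = 0) (hsolB : ∀ z : Γ, opB uhat z = 0) :
    ∃ u ∈ ADPINN.netClassParams Ω c σ 2 M,
      ADPINN.IsArgmin (ADPINN.loss F B Ωh Γh Dh ustar ωF ωB ωD αF αB αD ν)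
        (ADPINN.netClass Ω c σ 2) u ∧
      ADPINN.loss F B Ωh Γh Dh ustar ωF ωB ωD αF αB αD ν u = 0 := by

  have hΓh' : (Γh : Set (ADPINN.E d)) ⊆ frontier Ω := hΓh.trans hΓ
  obtain ⟨u, hu, huF, huB⟩ := ADPINN.exists_network_matching_jets hd hc hΩ rF rB Ωh Γh hΩh hΓh'
    hΩh_ne hℓ hM hσ ha uhat.1
  -- Needed because `0 ^ 0 = 1` would make `powNorm` of zero nonzero.
  have hν0 : ν ≠ 0 := by linarith
  have hzero : ADPINN.loss F B Ωh Γh Dh ustar ωF ωB ωD αF αB αD ν u = 0 := by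
    have h1 : ∀ z ∈ Ωh, F z (ADPINN.interiorJet rF u z) = 0 := fun z hz => by
      rw [huF z hz]
      exact (hF uhat ⟨z, hΩh hz⟩).symm.trans (hsolF _)
    have h2 : ∀ z ∈ Γh, B z (ADPINN.boundaryJet rB u z) = 0 := fun z hz => by
      rw [huB z hz]
      exact (hB uhat ⟨z, hΓh hz⟩).symm.trans (hsolB _)
    rw [ADPINN.loss, hαD, zero_mul, add_zero, Finset.sum_eq_zero, Finset.sum_eq_zero, mul_zero,
      mul_zero, add_zero]
    · intro z hz
      rw [h2 z hz, ADPINN.powNorm_zero hν0, mul_zero]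
    · intro z hz
      rw [h1 z hz, ADPINN.powNorm_zero hν0, mul_zero]
  refine ⟨u, hu, ⟨?_, fun v _ => ?_⟩, hzero⟩
  · obtain ⟨N, -, hN⟩ := hu
    exact ⟨N, hN⟩
  -- The data term, whose weights may be negative, is removed by `αD = 0`; the other two are
  -- nonnegative.
  · rw [hzero, ADPINN.loss, hαD, zero_mul, add_zero]
    exact add_nonneg
      (mul_nonneg hαF (Finset.sum_nonneg fun z hz =>
        mul_nonneg (hωF z hz) (ADPINN.powNorm_nonneg _ _)))
      (mul_nonneg hαB (Finset.sum_nonneg fun z hz =>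
        mul_nonneg (hωB z hz) (ADPINN.powNorm_nonneg _ _)))
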